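/- Let $G$ be a finite group. Call a group Dedekind if all its subgroups are normal. Call $G$ JND (just non-Dedekind) if $G$ is not Dedekind but $G/N$ is Dedekind for every normal subgroup $N \neq 1$ of $G$, and JNA (just nonabelian) if $G$ is not abelian but $G/N$ is abelian for every normal subgroup $N \neq 1$ of $G$. The monolith of $G$, if it exists, is the smallest nontrivial normal subgroup of $G$, i.e. a nontrivial normal subgroup contained in every nontrivial normal subgroup. Then the following are equivalent: (1) $G$ is solvable, and $G$ is JND but not JNA; (2) there are a prime $p$, a normal subgroup $A$ of $G$ and a subgroup $X$ of $G$ such that $A$ is an elementary abelian $p$-group and is the monolith of $G$, $X$ is a nonabelian Dedekind group, $A \cap X = 1$, $G = AX$, and the action of $X$ on $A$ by conjugation is faithful and irreducible (that is, $A \neq 1$ and the only subgroups of $A$ normalized by $X$ are $1$ and $A$). -/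

import Mathlib

universe u

/-- A group is Dedekind if all its subgroups are normal. -/
def IsDedekindGroup (G : Type u) [Group G] : Prop :=
  ∀ H : Subgroup G, H.Normal

/-- A group is abelian if any two of its elements commute. -/
def IsAbelianGroup (G : Type u) [Group G] : Prop :=
  ∀ a b : G, a * b = b * a

/-- For a group property `P`, a just non-`P` group is a group that does not have `P` but all of
whose proper homomorphic images (the quotients by nontrivial normal subgroups) have `P`. -/
def IsJustNon (P : ∀ (H : Type u) [Group H], Prop) (G : Type u) [Group G] : Prop :=
  ¬ P G ∧ ∀ (N : Subgroup G) [N.Normal], N ≠ ⊥ → P (G ⧸ N)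

/-- Just non-Dedekind groups. -/
def IsJND (G : Type u) [Group G] : Prop :=
  IsJustNon (fun H _ => IsDedekindGroup H) G

/-- Just nonabelian groups. -/
def IsJNA (G : Type u) [Group G] : Prop :=
  IsJustNon (fun H _ => IsAbelianGroup H) G

/-- `K` is the monolith of `G`: the smallest nontrivial normal subgroup. -/
def IsMonolith {G : Type u} [Group G] (K : Subgroup G) : Prop :=
  IsLeast {N : Subgroup G | N.Normal ∧ N ≠ ⊥} K

/-- `G` is an elementary abelian `p`-group: it is abelian and `g ^ p = 1` for all `g`
(to be used for a prime `p`). -/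
def IsElementaryAbelian (p : ℕ) (G : Type u) [Group G] : Prop :=
  IsAbelianGroup G ∧ ∀ g : G, g ^ p = 1

/-- The action of `X` on a normal subgroup `A` by conjugation, `(x, a) ↦ x * a * x⁻¹`. -/
def conjAction {G : Type u} [Group G] (A X : Subgroup G) [A.Normal] : X →* MulAut A :=
  (MulAut.conjNormal (H := A)).comp X.subtype

/-- An action of `X` on a group `A` by automorphisms is faithful if only `1` acts trivially. -/
def ActsFaithfully {X A : Type u} [Group X] [Group A] (φ : X →* MulAut A) : Prop :=
  Function.Injective φ

/-- An action of `X` on a group `A` by automorphisms is irreducible if `A` is nontrivial and has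
no `X`-invariant subgroups other than `1` and `A`. -/
def ActsIrreducibly {X A : Type u} [Group X] [Group A] (φ : X →* MulAut A) : Prop :=
  Nontrivial A ∧
    ∀ B : Subgroup A, (∀ (x : X), ∀ b ∈ B, φ x b ∈ B) → B = ⊥ ∨ B = ⊤

/-!
The group `G` is treated according to whether it is nilpotent.

If `G` is not nilpotent, it has a nonnormal maximal subgroup `X`, and `X` is core-free because the
proper quotients of `G` are Dedekind. These quotients are nilpotent, so two minimal normal subgroups
cannot coexist (`G` would embed in a product of two nilpotent groups) and `G` has a monolith `A`. It
is elementary abelian by solvability, and `X` is a complement to it (`IsJND.exists_complement`).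
Since `G = AX` with `A` abelian, a subgroup of `A` normalized by `X` is normal in `G`, which gives
irreducibility, and so is the centralizer of `A` in `X`, which gives faithfulness. As `X` is
isomorphic to `G ⧸ A`, it is Dedekind, and it is nonabelian because otherwise `G` would be just
nonabelian.

If `G` is nilpotent and just non-Dedekind, it is just nonabelian (`IsJND.isJNA_of_isNilpotent`).
The centre `Z(G)` has no two nontrivial subgroups with trivial intersection
(`IsJND.inf_ne_bot_of_le_center`). If some proper quotient were nonabelian, so would be `G ⧸ Z` for
a central subgroup `Z` of prime order. This quotient contains noncommuting elements with
`a ^ 2 = ⁅a, b⁆` (`IsDedekindGroup.exists_sq_eq_commutator`), and for lifts of them to `G` the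
commutator `⁅a, b⁆` is a central involution outside `Z`, so that the subgroup it generates meets `Z`
trivially, a contradiction.

Conversely, in a group as in the second condition a nontrivial normal subgroup contains `A`, so the
proper quotients of `G` are quotients of `G ⧸ A`, which is isomorphic to the Dedekind group `X`;
solvability follows since finite Dedekind groups are nilpotent. The complement `X` is not normal, as
it does not contain the monolith.
-/

open scoped commutatorElement

/-! ### Commutators of elements that commute with them -/

theorem commute_iff_commutator {G : Type*} [Group G] {a b : G} : Commute a b ↔ ⁅a, b⁆ = 1 :=
  commutatorElement_eq_one_iff_commute.symm

theorem commutator_pow_left {G : Type*} [Group G] {a b : G} (h : Commute a ⁅a, b⁆) (n : ℕ) :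
    ⁅a ^ n, b⁆ = ⁅a, b⁆ ^ n := by
  induction n with
  | zero => simp
  | succ n ih =>
    have e : ⁅a ^ (n + 1), b⁆ = a ^ n * ⁅a, b⁆ * (a ^ n)⁻¹ * ⁅a ^ n, b⁆ := by
      simp only [commutatorElement_def, pow_succ]; group
    rw [e, ih, (h.pow_left n).eq, mul_inv_cancel_right, pow_succ']

theorem commutator_pow_right {G : Type*} [Group G] {a b : G} (h : Commute b ⁅a, b⁆) (n : ℕ) :
    ⁅a, b ^ n⁆ = ⁅a, b⁆ ^ n := by
  have h' : Commute b ⁅b, a⁆ := by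
    rw [← commutatorElement_inv]; exact h.inv_right
  rw [← commutatorElement_inv, commutator_pow_left h', ← inv_pow, commutatorElement_inv]

/-- The power formula in nilpotency class two. -/
theorem mul_pow_eq_pow_choose {G : Type*} [Group G] {x b w : G} (hx : Commute x w)
    (hb : Commute b w) (h : b * x = x * b * w) (n : ℕ) :
    (x * b) ^ n = x ^ n * b ^ n * w ^ n.choose 2 := by
  have key : ∀ n : ℕ, b ^ n * x = x * b ^ n * w ^ n := by
    intro n
    induction n with
    | zero => simp
    | succ n ih =>
      have hw : Commute b (w ^ n) := hb.pow_right n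
      calc b ^ (n + 1) * x = b * (b ^ n * x) := by rw [pow_succ', mul_assoc]
        _ = (b * x) * b ^ n * w ^ n := by rw [ih]; simp only [mul_assoc]
        _ = x * b * (w * b ^ n) * w ^ n := by rw [h]; simp only [mul_assoc]
        _ = x * (b * b ^ n) * (w * w ^ n) := by
          rw [← (hb.pow_left n).eq]; simp only [mul_assoc]
        _ = _ := by rw [← pow_succ', ← pow_succ']
  induction n with
  | zero => simp
  | succ n ih =>
    have hbw : Commute b (w ^ n.choose 2) := hb.pow_right _
    have hxw : Commute x (w ^ n.choose 2) := hx.pow_right _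
    calc (x * b) ^ (n + 1) = x ^ n * b ^ n * (w ^ n.choose 2 * (x * b)) := by
          rw [pow_succ, ih]; simp only [mul_assoc]
      _ = x ^ n * (b ^ n * x) * b * w ^ n.choose 2 := by
          rw [← (hxw.mul_left hbw).eq]; simp only [mul_assoc]
      _ = x ^ n * x * b ^ n * (w ^ n * b) * w ^ n.choose 2 := by
          rw [key]; simp only [mul_assoc]
      _ = x ^ n * x * (b ^ n * b) * (w ^ n * w ^ n.choose 2) := by
          rw [← (hb.pow_right n).eq]; simp only [mul_assoc]
      _ = _ := by
          rw [← pow_succ, ← pow_succ, ← pow_add, Nat.choose_succ_succ' n 1, Nat.choose_one_right]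

/-! ### Quaternion pairs in nonabelian Dedekind groups -/

theorem IsDedekindGroup.commutator_mem_zpowers_left {G : Type u} [Group G]
    (hG : IsDedekindGroup G) (a b : G) : ⁅a, b⁆ ∈ Subgroup.zpowers a := by
  rw [commutatorElement_def, mul_assoc, mul_assoc]
  refine mul_mem (Subgroup.mem_zpowers a) ?_
  rw [← mul_assoc]
  exact (hG _).conj_mem _ (inv_mem (Subgroup.mem_zpowers a)) b

theorem IsDedekindGroup.commutator_mem_zpowers_right {G : Type u} [Group G]
    (hG : IsDedekindGroup G) (a b : G) : ⁅a, b⁆ ∈ Subgroup.zpowers b := by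
  rw [← commutatorElement_inv]
  exact inv_mem (hG.commutator_mem_zpowers_left b a)

theorem commute_of_mem_zpowers {G : Type*} [Group G] {a x : G} (h : x ∈ Subgroup.zpowers a) :
    Commute a x := by
  obtain ⟨k, rfl⟩ := h
  exact (Commute.refl a).zpow_right k

/-- In a cyclic group of order `q ^ (s + 1)` generated by `a`, the elements killed by `q` are powers
of `a ^ (q ^ s)`. -/
theorem exists_eq_zpow_of_pow_prime_eq_one {G : Type*} [Group G] {a c : G} {q s : ℕ}
    (hq : q.Prime) (ha : orderOf a = q ^ (s + 1)) (hc : c ∈ Subgroup.zpowers a)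
    (hcq : c ^ q = 1) : ∃ v : ℤ, c = a ^ ((q ^ s : ℕ) * v) := by
  obtain ⟨k, rfl⟩ := hc
  dsimp only at hcq ⊢
  have h1 : a ^ (k * (q : ℤ)) = 1 := by rw [zpow_mul, zpow_natCast]; exact hcq
  have h2 := orderOf_dvd_iff_zpow_eq_one.mpr h1
  rw [ha, pow_succ] at h2
  push_cast at h2
  obtain ⟨v, hv⟩ := Int.dvd_of_mul_dvd_mul_right (by exact_mod_cast hq.ne_zero) h2
  exact ⟨v, by rw [hv]; push_cast; rfl⟩

/-- The part of the Dedekind-Baer theorem that is needed here: a finite nonabelian Dedekind group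
contains noncommuting `a`, `b` satisfying the quaternion relation `a ^ 2 = ⁅a, b⁆`. Take a
noncommuting pair for which the sum of the orders is minimal. Then `⁅a, b⁆` has prime order `q`,
both generators have `q`-power order, and dividing the generator of smaller order by a suitable
power of the other one would lower its order, unless `q = 2` and this order is `4`. -/
theorem IsDedekindGroup.exists_sq_eq_commutator {D : Type u} [Group D] [Finite D]
    (hD : IsDedekindGroup D) (hna : ¬ IsAbelianGroup D) :
    ∃ a b : D, ⁅a, b⁆ ≠ 1 ∧ a ^ 2 = ⁅a, b⁆ := by
  have hex : ∃ n : ℕ, ∃ a b : D, ¬ Commute a b ∧ orderOf a + orderOf b = n := by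
    simp only [IsAbelianGroup, not_forall] at hna
    obtain ⟨a, b, h⟩ := hna
    exact ⟨_, a, b, h, rfl⟩
  classical
  obtain ⟨a, b, hab, hba, hmin⟩ : ∃ a b : D, ¬ Commute a b ∧ orderOf b ≤ orderOf a ∧
      ∀ x y : D, orderOf x + orderOf y < orderOf a + orderOf b → Commute x y := by
    obtain ⟨a, b, hab, hn⟩ := Nat.find_spec hex
    have hm : ∀ x y : D, orderOf x + orderOf y < orderOf a + orderOf b → Commute x y := by
      intro x y hxy
      by_contra h
      exact Nat.find_min hex (hn ▸ hxy) ⟨x, y, h, rfl⟩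
    rcases le_total (orderOf b) (orderOf a) with h | h
    · exact ⟨a, b, hab, h, hm⟩
    · exact ⟨b, a, fun h' => hab h'.symm, h, fun x y hxy => hm x y (by omega)⟩
  have hc1 : ⁅a, b⁆ ≠ 1 := fun h => hab (commute_iff_commutator.mpr h)
  have hca := hD.commutator_mem_zpowers_left a b
  have hcb := hD.commutator_mem_zpowers_right a b
  set c := ⁅a, b⁆ with hcdef
  have hac : Commute a c := commute_of_mem_zpowers hca
  have hbc : Commute b c := commute_of_mem_zpowers hcb
  have hlt : ∀ (x : D) (l : ℕ), l.Prime → l ∣ orderOf x → orderOf (x ^ l) < orderOf x := by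
    intro x l hl hd
    rw [orderOf_pow_of_dvd hl.ne_zero hd]
    exact Nat.div_lt_self (orderOf_pos x) hl.one_lt
  -- by minimality, replacing one generator by a prime power of it gives a commuting pair
  have hla : ∀ l : ℕ, l.Prime → l ∣ orderOf a → c ^ l = 1 := by
    intro l hl hd
    rw [hcdef, ← commutator_pow_left hac, ← commute_iff_commutator]
    exact hmin _ _ (by have := hlt a l hl hd; omega)
  have hlb : ∀ l : ℕ, l.Prime → l ∣ orderOf b → c ^ l = 1 := by
    intro l hl hd
    rw [hcdef, ← commutator_pow_right hbc, ← commute_iff_commutator]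
    exact hmin _ _ (by have := hlt b l hl hd; omega)
  have hb1 : orderOf b ≠ 1 := fun h => hab (by
    rw [orderOf_eq_one_iff] at h; rw [h]; exact Commute.one_right a)
  have ha1 : orderOf a ≠ 1 := fun h => hab (by
    rw [orderOf_eq_one_iff] at h; rw [h]; exact Commute.one_left b)
  obtain ⟨q, hq, hqb⟩ := Nat.exists_prime_and_dvd hb1
  have hcq : c ^ q = 1 := hlb q hq hqb
  have : Fact q.Prime := ⟨hq⟩
  have hoc : orderOf c = q := orderOf_eq_prime hcq hc1
  have huniq : ∀ l : ℕ, l.Prime → c ^ l = 1 → l = q := by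
    intro l hl h
    have := orderOf_dvd_of_pow_eq_one h
    rw [hoc] at this
    exact ((Nat.prime_dvd_prime_iff_eq hq hl).mp this).symm
  have hra := Nat.eq_prime_pow_of_unique_prime_dvd (orderOf_pos a).ne'
    (fun {d} hd hda => huniq d hd (hla d hd hda))
  have hrb := Nat.eq_prime_pow_of_unique_prime_dvd (orderOf_pos b).ne'
    (fun {d} hd hda => huniq d hd (hlb d hd hda))
  obtain ⟨s, hs⟩ : ∃ s, (orderOf a).primeFactorsList.length = s + 1 :=
    Nat.exists_eq_succ_of_ne_zero (fun h => ha1 (by rw [hra, h, pow_zero]))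
  obtain ⟨r, hr⟩ : ∃ r, (orderOf b).primeFactorsList.length = r + 1 :=
    Nat.exists_eq_succ_of_ne_zero (fun h => hb1 (by rw [hrb, h, pow_zero]))
  rw [hs] at hra
  rw [hr] at hrb
  have hrs : r ≤ s := by
    rw [hra, hrb] at hba
    have := (Nat.pow_le_pow_iff_right hq.one_lt).mp hba
    omega
  obtain ⟨v, hv⟩ := exists_eq_zpow_of_pow_prime_eq_one hq hra hca hcq
  -- `b ^ (q ^ r)` has order `q`, so it lies in `⟨c⟩`
  obtain ⟨u, hu⟩ : ∃ u : ℤ, b ^ (q ^ r) = c ^ u := by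
    obtain ⟨w, hw⟩ := exists_eq_zpow_of_pow_prime_eq_one hq hrb hcb hcq
    have hbq : (b ^ (q ^ r)) ^ q = 1 := by
      rw [← pow_mul, ← pow_succ, ← hrb, pow_orderOf_eq_one]
    have hob : orderOf (b ^ (q ^ r)) = q := by
      rw [orderOf_pow_of_dvd (pow_ne_zero _ hq.ne_zero)
        (by rw [hrb, pow_succ]; exact dvd_mul_right _ _),
        hrb, pow_succ, Nat.mul_div_cancel_left _ (pow_pos hq.pos r)]
    have hcw : c = (b ^ (q ^ r)) ^ w := by rw [hw, zpow_mul, zpow_natCast]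
    have hle : Subgroup.zpowers c ≤ Subgroup.zpowers (b ^ (q ^ r)) := by
      rw [Subgroup.zpowers_le]; exact ⟨w, hcw.symm⟩
    have heq := Subgroup.eq_of_le_of_card_ge hle (by
      rw [Nat.card_zpowers, Nat.card_zpowers, hoc, hob])
    have : b ^ (q ^ r) ∈ Subgroup.zpowers c := heq ▸ Subgroup.mem_zpowers _
    obtain ⟨u, hu⟩ := this
    exact ⟨u, hu.symm⟩
  obtain ⟨t, ht⟩ : ∃ t : ℤ, b ^ (q ^ r) = (a ^ t) ^ (q ^ r) := by
    refine ⟨(q ^ (s - r) : ℕ) * v * u, ?_⟩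
    rw [hu, hv, ← zpow_natCast, ← zpow_mul, ← zpow_mul]
    congr 1
    have : q ^ s = q ^ (s - r) * q ^ r := by rw [← pow_add]; congr 1; omega
    rw [this]; push_cast; ring
  have hr0 : r ≠ 0 := by
    rintro rfl
    rw [pow_zero, pow_one, pow_one] at ht
    exact hab (ht ▸ (Commute.refl a).zpow_right t)
  -- if `q` divided this binomial coefficient, `x * b` with `x = a ^ (-t)` would have smaller
  -- order than `b` without commuting with `a`
  have hch : ¬ q ∣ (q ^ r).choose 2 := by
    intro hdvd
    set x := (a ^ t)⁻¹ with hx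
    have hxc0 : Commute x c := (hac.zpow_left t).inv_left
    have hax : Commute a x := ((Commute.refl a).zpow_right t).inv_right
    have hxc : b * x = x * b * c ^ t := by
      have h1 : b * a * b⁻¹ = c⁻¹ * a := by
        rw [hcdef, commutatorElement_inv, commutatorElement_def]; group
      have h2 : b * x * b⁻¹ = c ^ t * x := by
        rw [hx, ← zpow_neg, ← conj_zpow, h1, hac.symm.inv_left.mul_zpow, inv_zpow', neg_neg]
      rw [mul_inv_eq_iff_eq_mul] at h2
      rw [h2, mul_assoc]
      exact ((hxc0.mul_left hbc).zpow_right t).symm.eq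
    have hxb : ¬ Commute a (x * b) := by
      intro h
      have := hax.inv_right.mul_right h
      rw [inv_mul_cancel_left] at this
      exact hab this
    have hpow : (x * b) ^ (q ^ r) = 1 := by
      obtain ⟨d, hd⟩ := hdvd
      rw [mul_pow_eq_pow_choose (hxc0.zpow_right t) (hbc.zpow_right t) hxc, ht, hx, inv_pow,
        inv_mul_cancel, one_mul, hd, pow_mul, ← zpow_natCast (c ^ t), ← zpow_mul, mul_comm t,
        zpow_mul, zpow_natCast, hcq, one_zpow, one_pow]
    have := hmin a (x * b) (by
      have h1 := Nat.le_of_dvd (pow_pos hq.pos r) (orderOf_dvd_of_pow_eq_one hpow)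
      have h2 : q ^ r < q ^ (r + 1) := Nat.pow_lt_pow_right hq.one_lt (by omega)
      omega)
    exact hxb this
  obtain ⟨rfl, rfl⟩ : q = 2 ∧ r = 1 := by
    have h2 : q ^ r * (q ^ r - 1) = (q ^ r).choose 2 * 2 := by
      have := Nat.add_one_mul_choose_eq (q ^ r - 1) 1
      rwa [Nat.sub_add_cancel (Nat.one_le_pow _ _ hq.pos), Nat.choose_one_right] at this
    by_contra hcon
    apply hch
    by_cases hq2 : q = 2
    · subst hq2
      obtain ⟨r', rfl⟩ : ∃ r', r = r' + 2 := ⟨r - 2, by omega⟩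
      refine ⟨2 ^ r' * (2 ^ (r' + 2) - 1), Nat.eq_of_mul_eq_mul_right two_pos ?_⟩
      rw [← h2, pow_add]; ring
    · have hd : q ∣ (q ^ r).choose 2 * 2 := h2 ▸ (dvd_pow_self q hr0).mul_right _
      exact (hq.dvd_mul.mp hd).resolve_right
        (fun h => hq2 ((Nat.prime_dvd_prime_iff_eq hq Nat.prime_two).mp h))
  have hba' : ⁅b, a⁆ = c := by
    rw [← commutatorElement_inv, ← hcdef, inv_eq_iff_mul_eq_one, ← pow_two, hcq]
  refine ⟨b, a, hba' ▸ hc1, ?_⟩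
  rw [hba']
  rw [pow_one] at hu
  rcases Int.even_or_odd' u with ⟨k, rfl | rfl⟩
  · have : b ^ 2 = 1 := by
      rw [hu, zpow_mul, zpow_ofNat, hcq, one_zpow]
    have := orderOf_dvd_of_pow_eq_one this
    rw [hrb] at this
    norm_num at this
  · rw [hu, zpow_add, zpow_mul, zpow_ofNat, hcq, one_zpow, one_mul, zpow_one]

/-! ### Quotients of abelian, Dedekind and just non-Dedekind groups -/

theorem IsAbelianGroup.isDedekindGroup {G : Type u} [Group G] (h : IsAbelianGroup G) :
    IsDedekindGroup G := fun H => ⟨fun n hn g => by rwa [h g n, mul_inv_cancel_right]⟩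

theorem IsAbelianGroup.of_surjective {G H : Type u} [Group G] [Group H] (h : IsAbelianGroup G)
    (f : G →* H) (hf : Function.Surjective f) : IsAbelianGroup H := by
  intro a b
  obtain ⟨a, rfl⟩ := hf a
  obtain ⟨b, rfl⟩ := hf b
  rw [← map_mul, h a b, map_mul]

theorem IsAbelianGroup.of_injective {G H : Type u} [Group G] [Group H] (h : IsAbelianGroup H)
    (f : G →* H) (hf : Function.Injective f) : IsAbelianGroup G :=
  fun a b => hf (by rw [map_mul, map_mul, h])

theorem IsAbelianGroup.quotient_of_le {G : Type u} [Group G] {M N : Subgroup G} [M.Normal]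
    [N.Normal] (hMN : M ≤ N) (h : IsAbelianGroup (G ⧸ M)) : IsAbelianGroup (G ⧸ N) := by
  intro a b
  induction a using QuotientGroup.induction_on with | _ a
  induction b using QuotientGroup.induction_on with | _ b
  have := h a b
  rw [← QuotientGroup.mk_mul, ← QuotientGroup.mk_mul, QuotientGroup.eq] at this ⊢
  exact hMN this

theorem IsDedekindGroup.of_surjective {G H : Type u} [Group G] [Group H]
    (h : IsDedekindGroup G) (f : G →* H) (hf : Function.Surjective f) : IsDedekindGroup H := by
  intro K
  have := (h (K.comap f)).map f hf
  rwa [Subgroup.map_comap_eq_self_of_surjective hf] at this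

theorem IsDedekindGroup.isNilpotent {G : Type u} [Group G] [Finite G] (h : IsDedekindGroup G) :
    Group.IsNilpotent G :=
  (Group.isNilpotent_of_finite_tfae.out 0 3 rfl rfl).mpr fun _ _ P => h P

theorem IsDedekindGroup.normal_of_le {G : Type u} [Group G] {N K : Subgroup G} [N.Normal]
    (h : IsDedekindGroup (G ⧸ N)) (hNK : N ≤ K) : K.Normal := by
  have := (h (K.map (QuotientGroup.mk' N))).comap (QuotientGroup.mk' N)
  rwa [Subgroup.comap_map_eq_self (by simpa using hNK)] at this

/-- Nonnormal subgroups of a just non-Dedekind group are core-free. -/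
theorem IsJND.eq_bot_of_normal_of_le {G : Type u} [Group G] (hG : IsJND G) {H N : Subgroup G}
    (hH : ¬ H.Normal) (hN : N.Normal) (hNH : N ≤ H) : N = ⊥ := by
  by_contra h
  exact hH ((hG.2 N h).normal_of_le hNH)

theorem IsJND.exists_not_normal {G : Type u} [Group G] (hG : IsJND G) :
    ∃ H : Subgroup G, ¬ H.Normal := not_forall.mp hG.1

theorem IsJND.not_isAbelianGroup {G : Type u} [Group G] (hG : IsJND G) : ¬ IsAbelianGroup G :=
  fun h => hG.1 h.isDedekindGroup

theorem IsJND.exists_not_isAbelianGroup_quotient {G : Type u} [Group G] (hG : IsJND G)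
    (h : ¬ IsJNA G) : ∃ (N : Subgroup G) (_ : N.Normal), N ≠ ⊥ ∧ ¬ IsAbelianGroup (G ⧸ N) := by
  by_contra hcon
  refine h ⟨hG.not_isAbelianGroup, fun N hN hne => ?_⟩
  by_contra hab
  exact hcon ⟨N, hN, hne, hab⟩

/-! ### Nilpotent just non-Dedekind groups -/

theorem normal_of_le_center {G : Type*} [Group G] {N : Subgroup G}
    (h : N ≤ Subgroup.center G) : N.Normal :=
  ⟨fun n hn g => by rwa [Subgroup.mem_center_iff.mp (h hn) g, mul_inv_cancel_right]⟩

/-- Nontrivial central subgroups of a just non-Dedekind group meet nontrivially: if `H` is not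
normal then `H ⊓ Z(G) = ⊥`, while `H ⊔ Y` and `H ⊔ Z` are normal and intersect in `H` as soon as
`Y ⊓ Z = ⊥`. -/
theorem IsJND.inf_ne_bot_of_le_center {G : Type u} [Group G] (hG : IsJND G) {Y Z : Subgroup G}
    (hY : Y ≤ Subgroup.center G) (hZ : Z ≤ Subgroup.center G) (hY1 : Y ≠ ⊥) (hZ1 : Z ≠ ⊥) :
    Y ⊓ Z ≠ ⊥ := by
  intro hYZ
  obtain ⟨H, hH⟩ := hG.exists_not_normal
  have := normal_of_le_center hY
  have := normal_of_le_center hZ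
  have hHY : (H ⊔ Y).Normal := (hG.2 Y hY1).normal_of_le le_sup_right
  have hHZ : (H ⊔ Z).Normal := (hG.2 Z hZ1).normal_of_le le_sup_right
  have hcore : H ⊓ Subgroup.center G = ⊥ :=
    hG.eq_bot_of_normal_of_le hH (normal_of_le_center inf_le_right) inf_le_left
  have heq : (H ⊔ Y) ⊓ (H ⊔ Z) = H := by
    refine le_antisymm (fun x hx => ?_) (le_inf le_sup_left le_sup_left)
    obtain ⟨h, hh, y, hy, rfl⟩ := Subgroup.mem_sup_of_normal_right.mp hx.1
    obtain ⟨k, hk, z, hz, hkz⟩ := Subgroup.mem_sup_of_normal_right.mp hx.2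
    have e : k⁻¹ * h = z * y⁻¹ := by
      rw [inv_mul_eq_iff_eq_mul, ← mul_assoc, hkz, mul_inv_cancel_right]
    have hb : z * y⁻¹ ∈ H ⊓ Subgroup.center G :=
      ⟨e ▸ H.mul_mem (H.inv_mem hk) hh, Subgroup.mul_mem _ (hZ hz) (Subgroup.inv_mem _ (hY hy))⟩
    rw [hcore, Subgroup.mem_bot, mul_inv_eq_one] at hb
    have : y ∈ Y ⊓ Z := ⟨hy, hb ▸ hz⟩
    rw [hYZ, Subgroup.mem_bot] at this
    rwa [this, mul_one]
  exact hH (heq ▸ inferInstance)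

theorem Group.IsNilpotent.inf_center_ne_bot {G : Type*} [Group G] [Group.IsNilpotent G]
    {N : Subgroup G} [hN : N.Normal] (h : N ≠ ⊥) : N ⊓ Subgroup.center G ≠ ⊥ := by
  intro hbot
  have key : ∀ n, N ⊓ Subgroup.upperCentralSeries G n = ⊥ := by
    intro n
    induction n with
    | zero => simp
    | succ n ih =>
      refine eq_bot_iff.mpr (fun x hx => hbot ▸ ⟨hx.1, Subgroup.mem_center_iff.mpr fun g => ?_⟩)
      have h1 := Subgroup.mem_upperCentralSeries_succ_iff.mp hx.2 g
      have h2 : x * g * x⁻¹ * g⁻¹ ∈ N := by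
        rw [mul_assoc, mul_assoc]
        exact mul_mem hx.1 (by rw [← mul_assoc]; exact hN.conj_mem _ (inv_mem hx.1) g)
      have h3 : x * g * x⁻¹ * g⁻¹ ∈ N ⊓ Subgroup.upperCentralSeries G n := ⟨h2, h1⟩
      rw [ih, Subgroup.mem_bot, mul_inv_eq_one, mul_inv_eq_iff_eq_mul] at h3
      exact h3.symm
  obtain ⟨n, hn⟩ := Group.IsNilpotent.nilpotent G
  have := key n
  rw [hn, inf_top_eq] at this
  exact h this

/-- Otherwise a quaternion pair modulo `Z` lifts to `a`, `b` such that `⁅a, b⁆` is a central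
involution outside `Z`, and it generates a central subgroup meeting `Z` trivially. -/
theorem IsJND.isAbelianGroup_quotient_of_le_center {G : Type u} [Group G] [Finite G] (hG : IsJND G)
    {Z : Subgroup G} [Z.Normal] (hZ : Z ≤ Subgroup.center G) {p : ℕ} (hp : p.Prime)
    (hZp : ∀ z ∈ Z, z ^ p = 1) (hZ1 : Z ≠ ⊥) : IsAbelianGroup (G ⧸ Z) := by
  have hD : IsDedekindGroup (G ⧸ Z) := hG.2 Z hZ1
  by_contra hna
  obtain ⟨a', b', hab, hsq⟩ := hD.exists_sq_eq_commutator hna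
  obtain ⟨a, rfl⟩ := QuotientGroup.mk'_surjective Z a'
  obtain ⟨b, rfl⟩ := QuotientGroup.mk'_surjective Z b'
  have hzc : ∀ z ∈ Z, ∀ g : G, Commute g z := fun z hz g => Subgroup.mem_center_iff.mp (hZ hz) g
  have lift : ∀ x y : G, QuotientGroup.mk' Z x ∈ Subgroup.zpowers (QuotientGroup.mk' Z y) →
      ∃ k : ℤ, ∃ z ∈ Z, x = y ^ k * z := by
    rintro x y ⟨k, hk⟩
    refine ⟨k, (y ^ k)⁻¹ * x, ?_, by group⟩
    rw [← QuotientGroup.eq]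
    exact hk
  rw [← map_commutatorElement] at hab hsq
  set c := ⁅a, b⁆ with hc
  have hcZ : c ∉ Z := fun h => hab ((QuotientGroup.eq_one_iff c).mpr h)
  have hac : Commute a c := by
    obtain ⟨k, z, hz, h⟩ := lift c a (by
      rw [hc, map_commutatorElement]; exact hD.commutator_mem_zpowers_left _ _)
    rw [h]
    exact ((Commute.refl a).zpow_right k).mul_right (hzc z hz a)
  have hbc : Commute b c := by
    obtain ⟨k, z, hz, h⟩ := lift c b (by
      rw [hc, map_commutatorElement]; exact hD.commutator_mem_zpowers_right _ _)
    rw [h]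
    exact ((Commute.refl b).zpow_right k).mul_right (hzc z hz b)
  obtain ⟨z, hz, hcz⟩ : ∃ z ∈ Z, a ^ 2 = c * z := by
    refine ⟨c⁻¹ * a ^ 2, ?_, by group⟩
    rw [← QuotientGroup.eq]
    exact hsq.symm
  have hc2 : c ^ 2 = 1 := by
    rw [hc, ← commutator_pow_left hac, ← commute_iff_commutator, hcz]
    exact (hbc.symm.mul_left (hzc z hz b).symm)
  have hcen : c ∈ Subgroup.center G := by
    rw [Subgroup.mem_center_iff]
    intro g
    rw [← mul_inv_eq_iff_eq_mul]
    -- conjugation by `g` sends `a` to some `a ^ k * y` with `y ∈ Z`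
    obtain ⟨k, y, hy, h⟩ := lift (g * a * g⁻¹) a (by
      rw [map_mul, map_mul, map_inv]
      exact (hD _).conj_mem _ (Subgroup.mem_zpowers _) _)
    have h1 : g * c * g⁻¹ * z = (c * z) ^ k * y ^ 2 := by
      have e1 : g * c * g⁻¹ * z = g * (c * z) * g⁻¹ := by
        rw [mul_assoc _ _ z, (hzc z hz g⁻¹).eq]; simp only [mul_assoc]
      rw [e1, ← hcz, ← conj_pow, h, ((hzc y hy a).zpow_left k).mul_pow, ← zpow_natCast (a ^ k),
        zpow_comm, zpow_natCast]
    rw [(hzc z hz c).mul_zpow] at h1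
    rcases Int.even_or_odd' k with ⟨m, rfl | rfl⟩
    · -- an even `k` would force the conjugate of `c` into `Z`
      exfalso
      rw [zpow_mul c, zpow_ofNat, hc2, one_zpow, one_mul] at h1
      have : g * c * g⁻¹ ∈ Z := by
        rw [eq_mul_inv_of_mul_eq h1]
        exact mul_mem (mul_mem (zpow_mem hz _) (pow_mem hy 2)) (inv_mem hz)
      have := ‹Z.Normal›.conj_mem _ this g⁻¹
      exact hcZ (by simpa [mul_assoc] using this)
    · have hw : z ^ m * y ∈ Z := mul_mem (zpow_mem hz m) hy
      have h2 : g * c * g⁻¹ = c * (z ^ m * y) ^ 2 := by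
        rw [zpow_add, zpow_mul c, zpow_ofNat, hc2, one_zpow, one_mul, zpow_one] at h1
        rw [← mul_left_inj z, h1, ((hzc y hy (z ^ m))).mul_pow, zpow_add, zpow_one,
          mul_comm 2 m, zpow_mul, zpow_ofNat]
        have := (hzc (y ^ 2) (pow_mem hy 2) z).eq
        simp only [mul_assoc, this]
      -- comparing orders, `(z ^ m * y) ^ 2` is trivial whether `p` is even or odd
      have h4 : (z ^ m * y) ^ 4 = 1 := by
        have : (g * c * g⁻¹) ^ 2 = 1 := by rw [conj_pow, hc2]; group
        rw [h2, (hzc _ (pow_mem hw 2) c).mul_pow, hc2, one_mul, ← pow_mul] at this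
        exact this
      rw [h2]
      have h5 : (z ^ m * y) ^ 2 = 1 := by
        by_cases hp2 : p = 2
        · exact hp2 ▸ hZp _ hw
        · have hcop : Nat.Coprime p (2 ^ 2) :=
            ((Nat.coprime_primes hp Nat.prime_two).mpr hp2).pow_right 2
          have := Nat.dvd_gcd (orderOf_dvd_of_pow_eq_one (hZp _ hw))
            (orderOf_dvd_of_pow_eq_one (n := 2 ^ 2) h4)
          rw [hcop, Nat.dvd_one, orderOf_eq_one_iff] at this
          rw [this, one_pow]
      rw [h5, mul_one]
  refine hG.inf_ne_bot_of_le_center (Y := Subgroup.zpowers c) (by simpa using hcen) hZ ?_ hZ1 ?_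
  · rw [Subgroup.zpowers_ne_bot]
    exact fun h => hcZ (h ▸ one_mem Z)
  · refine eq_bot_iff.mpr ?_
    rintro x ⟨⟨k, rfl⟩, hx⟩
    dsimp only at hx ⊢
    rcases Int.even_or_odd' k with ⟨m, rfl | rfl⟩
    · rw [zpow_mul, zpow_ofNat, hc2, one_zpow]; exact one_mem _
    · rw [zpow_add, zpow_mul, zpow_ofNat, hc2, one_zpow, one_mul, zpow_one] at hx
      exact absurd hx hcZ

theorem IsJND.isJNA_of_isNilpotent {G : Type u} [Group G] [Finite G] [Group.IsNilpotent G]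
    (hG : IsJND G) : IsJNA G := by
  by_contra hJ
  obtain ⟨N, hN, hN1, hNa⟩ := hG.exists_not_isAbelianGroup_quotient hJ
  have hne := Group.IsNilpotent.inf_center_ne_bot hN1
  have : Nontrivial ↥(N ⊓ Subgroup.center G) := (Subgroup.nontrivial_iff_ne_bot _).mpr hne
  obtain ⟨p, hp, hpd⟩ := Nat.exists_prime_and_dvd
    (Finite.one_lt_card (α := ↥(N ⊓ Subgroup.center G))).ne'
  have : Fact p.Prime := ⟨hp⟩
  obtain ⟨⟨z, hz⟩, hzp⟩ := exists_prime_orderOf_dvd_card' p hpd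
  rw [Subgroup.orderOf_mk] at hzp
  have hZ : Subgroup.zpowers z ≤ N ⊓ Subgroup.center G := by simpa using hz
  have := normal_of_le_center (hZ.trans inf_le_right)
  refine hNa ((hG.isAbelianGroup_quotient_of_le_center
    (hZ.trans inf_le_right) hp ?_ ?_).quotient_of_le (hZ.trans inf_le_left))
  · rintro x ⟨k, rfl⟩
    dsimp only
    rw [← zpow_natCast, zpow_comm, zpow_natCast, ← hzp, pow_orderOf_eq_one, one_zpow]
  · rw [Subgroup.zpowers_ne_bot]
    rintro rfl
    rw [orderOf_one] at hzp
    exact hp.ne_one hzp.symm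

/-! ### The monolith and its complement -/

theorem bijective_mk_comp_subtype {G : Type*} [Group G] {A X : Subgroup G} [A.Normal]
    (hinf : A ⊓ X = ⊥) (hsup : ∀ g : G, ∃ a ∈ A, ∃ x ∈ X, g = a * x) :
    Function.Bijective ((QuotientGroup.mk' A).comp X.subtype) := by
  constructor
  · rw [injective_iff_map_eq_one]
    intro x hx
    have h : (x : G) ∈ A ⊓ X := ⟨(QuotientGroup.eq_one_iff _).mp hx, x.2⟩
    rw [hinf, Subgroup.mem_bot] at h
    exact Subtype.ext h
  · intro q
    obtain ⟨g, rfl⟩ := QuotientGroup.mk'_surjective A q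
    obtain ⟨a, ha, x, hx, rfl⟩ := hsup g
    refine ⟨⟨x, hx⟩, ?_⟩
    have : QuotientGroup.mk' A a = 1 := (QuotientGroup.eq_one_iff _).mpr ha
    rw [map_mul, this, one_mul]
    rfl

/-- If two nontrivial normal subgroups met trivially, `G` would embed in the product of two
nilpotent quotients. -/
theorem exists_isMonolith_of_quotients_isNilpotent {G : Type*} [Group G] [Finite G]
    (hG : ¬ Group.IsNilpotent G)
    (hq : ∀ (N : Subgroup G) [N.Normal], N ≠ ⊥ → Group.IsNilpotent (G ⧸ N)) :
    ∃ A : Subgroup G, IsMonolith A := by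
  have : Nontrivial G := by
    by_contra h
    rw [not_nontrivial_iff_subsingleton] at h
    exact hG inferInstance
  obtain ⟨A, hA⟩ := (Set.toFinite {N : Subgroup G | N.Normal ∧ N ≠ ⊥}).exists_minimal
    ⟨⊤, inferInstance, top_ne_bot⟩
  refine ⟨A, hA.prop, fun N hN => ?_⟩
  have := hA.prop.1
  have := hN.1
  by_cases h : A ⊓ N = ⊥
  · have := hq A hA.prop.2
    have := hq N hN.2
    refine absurd (Subgroup.isNilpotent_of_ker_le_center
      ((QuotientGroup.mk' A).prod (QuotientGroup.mk' N)) ?_) hG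
    rw [MonoidHom.ker_prod, QuotientGroup.ker_mk', QuotientGroup.ker_mk', h]
    exact bot_le
  · exact (hA.le_of_le ⟨inferInstance, h⟩ inf_le_left).trans inf_le_right

theorem IsMonolith.isAbelianGroup {G : Type u} [Group G] [Group.IsSolvable G] {A : Subgroup G}
    (hA : IsMonolith A) : IsAbelianGroup A := by
  have := hA.1.1
  have h : ⁅A, A⁆ = ⊥ := by
    by_contra hne
    exact (Group.IsSolvable.commutator_lt_of_ne_bot hA.1.2).not_ge
      (hA.2 ⟨inferInstance, hne⟩)
  intro a b
  have := Subgroup.commutator_mem_commutator a.2 b.2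
  rw [h, Subgroup.mem_bot, commutatorElement_eq_one_iff_mul_comm] at this
  exact Subtype.ext this

/-- For a prime `p` dividing the order of an abelian monolith `A`, the elements of `A` killed by
`p` form a nontrivial normal subgroup, hence all of `A`. -/
theorem IsMonolith.exists_isElementaryAbelian {G : Type u} [Group G] [Finite G] {A : Subgroup G}
    (hA : IsMonolith A) (hab : IsAbelianGroup A) : ∃ p : ℕ, p.Prime ∧ IsElementaryAbelian p A := by
  have hAn := hA.1.1
  have : Nontrivial A := (Subgroup.nontrivial_iff_ne_bot _).mpr hA.1.2
  obtain ⟨p, hp, hpd⟩ := Nat.exists_prime_and_dvd (Finite.one_lt_card (α := A)).ne'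
  have : Fact p.Prime := ⟨hp⟩
  obtain ⟨z, hzp⟩ := exists_prime_orderOf_dvd_card' p hpd
  have hcomm : ∀ a ∈ A, ∀ b ∈ A, Commute a b := fun a ha b hb =>
    congrArg Subtype.val (hab ⟨a, ha⟩ ⟨b, hb⟩)
  let T : Subgroup G :=
    { carrier := {a | a ∈ A ∧ a ^ p = 1}
      one_mem' := ⟨one_mem A, one_pow p⟩
      mul_mem' := fun {a b} ha hb =>
        ⟨mul_mem ha.1 hb.1, by rw [(hcomm a ha.1 b hb.1).mul_pow, ha.2, hb.2, one_mul]⟩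
      inv_mem' := fun {a} ha => ⟨inv_mem ha.1, by rw [inv_pow, ha.2, inv_one]⟩ }
  have hTn : T.Normal :=
    ⟨fun a ha g => ⟨hAn.conj_mem a ha.1 g, by rw [conj_pow, ha.2, mul_one, mul_inv_cancel]⟩⟩
  have hT1 : T ≠ ⊥ := by
    intro h
    have hz : (z : G) ∈ T := ⟨z.2, by
      rw [← Subgroup.coe_pow, ← hzp, pow_orderOf_eq_one, Subgroup.coe_one]⟩
    rw [h, Subgroup.mem_bot, OneMemClass.coe_eq_one] at hz
    rw [hz, orderOf_one] at hzp
    exact hp.ne_one hzp.symm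
  exact ⟨p, hp, hab, fun a => Subtype.ext (hA.2 ⟨hTn, hT1⟩ a.2).2⟩

/-- A subgroup normalized by `X` and centralized by `A` is normal in `G = AX`. -/
theorem normal_of_forall_conj_mem {G : Type*} [Group G] {A X N : Subgroup G}
    (hsup : ∀ g : G, ∃ a ∈ A, ∃ x ∈ X, g = a * x)
    (hX : ∀ x ∈ X, ∀ n ∈ N, x * n * x⁻¹ ∈ N) (hA : ∀ a ∈ A, ∀ n ∈ N, Commute a n) :
    N.Normal := by
  refine ⟨fun n hn g => ?_⟩
  obtain ⟨a, ha, x, hx, rfl⟩ := hsup g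
  have h := hX x hx n hn
  have e : a * x * n * (a * x)⁻¹ = a * (x * n * x⁻¹) * a⁻¹ := by group
  rwa [e, (hA a ha _ h).eq, mul_inv_cancel_right]

theorem coe_conjAction {G : Type u} [Group G] {A X : Subgroup G} [A.Normal] (x : X) (a : A) :
    ((conjAction A X x a : A) : G) = x * a * (x : G)⁻¹ := rfl

theorem IsMonolith.actsIrreducibly {G : Type u} [Group G] {A X : Subgroup G} [A.Normal]
    (hA : IsMonolith A) (hab : IsAbelianGroup A)
    (hsup : ∀ g : G, ∃ a ∈ A, ∃ x ∈ X, g = a * x) : ActsIrreducibly (conjAction A X) := by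
  refine ⟨(Subgroup.nontrivial_iff_ne_bot _).mpr hA.1.2, fun B hB => ?_⟩
  have hn : (B.map A.subtype).Normal := by
    refine normal_of_forall_conj_mem hsup ?_ ?_
    · rintro x hx _ ⟨b, hb, rfl⟩
      exact ⟨_, hB ⟨x, hx⟩ b hb, rfl⟩
    · rintro a ha _ ⟨b, -, rfl⟩
      exact congrArg Subtype.val (hab ⟨a, ha⟩ b)
  refine or_iff_not_imp_left.mpr fun hne => eq_top_iff.mpr fun a _ => ?_
  have hle : A ≤ B.map A.subtype := hA.2 ⟨hn, fun h => hne
    ((Subgroup.map_eq_bot_iff_of_injective B A.subtype_injective).mp h)⟩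
  obtain ⟨b, hb, hba⟩ := hle a.2
  rwa [← Subtype.ext hba]

theorem IsMonolith.actsFaithfully {G : Type u} [Group G] {A X : Subgroup G} [A.Normal]
    (hA : IsMonolith A) (hinf : A ⊓ X = ⊥)
    (hsup : ∀ g : G, ∃ a ∈ A, ∃ x ∈ X, g = a * x) : ActsFaithfully (conjAction A X) := by
  have hn : (X ⊓ Subgroup.centralizer (A : Set G)).Normal := by
    refine normal_of_forall_conj_mem hsup ?_ ?_
    · intro x hx n hn
      have := (inferInstance : (Subgroup.centralizer (A : Set G)).Normal)
      exact ⟨X.mul_mem (X.mul_mem hx hn.1) (X.inv_mem hx), this.conj_mem n hn.2 x⟩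
    · exact fun a ha n hn => Subgroup.mem_centralizer_iff.mp hn.2 a ha
  have hbot : X ⊓ Subgroup.centralizer (A : Set G) = ⊥ := by
    by_contra hne
    refine hA.1.2 (eq_bot_iff.mpr ?_)
    rw [← hinf]
    exact le_inf le_rfl ((hA.2 ⟨hn, hne⟩).trans inf_le_left)
  refine (injective_iff_map_eq_one _).mpr fun x hx => Subtype.ext ?_
  rw [Subgroup.coe_one, ← Subgroup.mem_bot, ← hbot]
  refine ⟨x.2, Subgroup.mem_centralizer_iff.mpr fun a ha => ?_⟩
  have := congrArg Subtype.val (DFunLike.congr_fun hx (⟨a, ha⟩ : A))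
  rw [coe_conjAction] at this
  exact (mul_inv_eq_iff_eq_mul.mp this).symm

/-- A nonnormal maximal subgroup `X` of `G` complements the monolith. -/
theorem IsJND.exists_complement {G : Type u} [Group G] [Finite G] (hG : IsJND G)
    (hnil : ¬ Group.IsNilpotent G) {A : Subgroup G} (hA : IsMonolith A)
    (hab : IsAbelianGroup A) :
    ∃ X : Subgroup G, A ⊓ X = ⊥ ∧ ∀ g : G, ∃ a ∈ A, ∃ x ∈ X, g = a * x := by
  obtain ⟨X, hX, hXn⟩ : ∃ X : Subgroup G, IsCoatom X ∧ ¬ X.Normal := by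
    by_contra! h
    exact hnil ((Group.isNilpotent_of_finite_tfae.out 0 2 rfl rfl).mpr h)
  have hAn := hA.1.1
  have hAX : ¬ A ≤ X := fun h => hA.1.2 (hG.eq_bot_of_normal_of_le hXn hAn h)
  have hsup : ∀ g : G, ∃ a ∈ A, ∃ x ∈ X, g = a * x := by
    intro g
    have : A ⊔ X = ⊤ := by
      rw [sup_comm]; exact hX.2 _ (left_lt_sup.mpr hAX)
    obtain ⟨a, ha, x, hx, h⟩ := Subgroup.mem_sup_of_normal_left.mp (this ▸ Subgroup.mem_top g)
    exact ⟨a, ha, x, hx, h.symm⟩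
  refine ⟨X, hG.eq_bot_of_normal_of_le hXn ?_ inf_le_right, hsup⟩
  refine normal_of_forall_conj_mem hsup ?_ ?_
  · exact fun x hx n hn => ⟨hAn.conj_mem n hn.1 x, X.mul_mem (X.mul_mem hx hn.2) (X.inv_mem hx)⟩
  · exact fun a ha n hn => congrArg Subtype.val (hab ⟨a, ha⟩ ⟨n, hn.1⟩)

/-! ### The equivalence -/

theorem lemma3p4 (G : Type*) [Group G] [Finite G] :
    (Group.IsSolvable G ∧ IsJND G ∧ ¬ IsJNA G) ↔
      ∃ p : ℕ, p.Prime ∧ ∃ (A X : Subgroup G) (_ : A.Normal),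
        IsElementaryAbelian p A ∧ IsMonolith A ∧
        ¬ IsAbelianGroup X ∧ IsDedekindGroup X ∧
        A ⊓ X = ⊥ ∧ (∀ g : G, ∃ a ∈ A, ∃ x ∈ X, g = a * x) ∧
        ActsFaithfully (conjAction A X) ∧ ActsIrreducibly (conjAction A X) := by
  constructor
  · rintro ⟨hsol, hG, hJ⟩
    have hnil : ¬ Group.IsNilpotent G := fun h => hJ hG.isJNA_of_isNilpotent
    obtain ⟨A, hA⟩ := exists_isMonolith_of_quotients_isNilpotent hnil
      fun N _ hN => (hG.2 N hN).isNilpotent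
    have hab := hA.isAbelianGroup
    obtain ⟨p, hp, hel⟩ := hA.exists_isElementaryAbelian hab
    obtain ⟨X, hinf, hsup⟩ := hG.exists_complement hnil hA hab
    have hAn := hA.1.1
    have hbij := bijective_mk_comp_subtype hinf hsup
    refine ⟨p, hp, A, X, hAn, hel, hA, fun hXab => ?_, ?_, hinf, hsup,
      hA.actsFaithfully hinf hsup, hA.actsIrreducibly hab hsup⟩
    · obtain ⟨N, hN, hN1, hNa⟩ := hG.exists_not_isAbelianGroup_quotient hJ
      exact hNa ((hXab.of_surjective _ hbij.2).quotient_of_le (hA.2 ⟨hN, hN1⟩))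
    · let e := MulEquiv.ofBijective _ hbij
      exact (hG.2 A hA.1.2).of_surjective e.symm.toMonoidHom e.symm.surjective
  · rintro ⟨p, -, A, X, hAn, hel, hA, hXna, hXD, hinf, hsup, -, -⟩
    have hbij := bijective_mk_comp_subtype hinf hsup
    have hAD : IsDedekindGroup (G ⧸ A) := hXD.of_surjective _ hbij.2
    refine ⟨?_, ⟨fun hG => ?_, fun N hN hN1 H => ?_⟩, fun hJ => ?_⟩
    · have := hAD.isNilpotent
      exact (Group.isSolvable_iff_subgroup_quotient A).mpr
        ⟨Group.isSolvable_of_comm hel.1, inferInstance⟩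
    · -- if `X` were normal it would contain the monolith
      have hX1 : X ≠ ⊥ := by
        rintro rfl
        exact hXna fun a b => Subsingleton.elim _ _
      exact hA.1.2 (le_bot_iff.mp (hinf ▸ le_inf le_rfl (hA.2 ⟨hG X, hX1⟩)))
    · have h : (H.comap (QuotientGroup.mk' N)).Normal := by
        refine hAD.normal_of_le ((hA.2 ⟨hN, hN1⟩).trans ?_)
        conv_lhs => rw [← QuotientGroup.ker_mk' N]
        exact Subgroup.ker_le_comap _ _
      have := h.map _ (QuotientGroup.mk'_surjective N)
      rwa [Subgroup.map_comap_eq_self_of_surjective (QuotientGroup.mk'_surjective N)] at this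
    · exact hXna ((hJ.2 A hA.1.2).of_injective _ hbij.1)
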